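/- Let $\mathcal X$ be a set of datasets with a symmetric neighbouring relation $\sim$. A mechanism $M$ on $\mathcal X$ with outcomes in a measurable space $Y$ assigns to every $x\in\mathcal X$ the probability law of an outcome $M(x)\in Y$. It is $(\varepsilon,\delta)$-DP if $\Pr[M(x)\in S]\le e^{\varepsilon}\Pr[M(x')\in S]+\delta$ for all $x\sim x'$ and all measurable $S\subseteq Y$, and $\varepsilon$-DP if it is $(\varepsilon,0)$-DP. It is $\varepsilon$-bounded range ($\varepsilon$-BR) if for all $x\sim x'$ and all measurable $S_1,S_2\subseteq Y$ $$\Pr[M(x)\in S_1]\,\Pr[M(x')\in S_2]\le e^{\varepsilon}\,\Pr[M(x)\in S_2]\,\Pr[M(x')\in S_1];$$ for discrete $Y$ this means that $\frac{\Pr[M(x)=y_1]}{\Pr[M(x')=y_1]}\le e^{\varepsilon}\frac{\Pr[M(x)=y_2]}{\Pr[M(x')=y_2]}$ for all $y_1,y_2\in Y$. Let $\mathcal M_{\mathrm{DP}}(\varepsilon)$ and $\mathcal M_{\mathrm{BR}}(\varepsilon)$ be the classes of all $\varepsilon$-DP and of all $\varepsilon$-BR mechanisms. For classes $\mathcal A_1,\dots,\mathcal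 A_N$ of mechanisms, let $(\mathcal A_1,\dots,\mathcal A_N)$ be the class of their adaptive compositions: on the dataset $x$ one runs successively $M_1(x)$, $M_2(x,y_1)$, \dots, $M_N(x,y_1,\dots,y_{N-1})$, where $y_i$ is the outcome of the $i$-th run, and outputs $(y_1,\dots,y_N)$; here the law of $M_i(x,y_1,\dots,y_{i-1})$ depends measurably on $(y_1,\dots,y_{i-1})$ and $M_i(\cdot,y_1,\dots,y_{i-1})\in\mathcal A_i$ for all $y_1,\dots,y_{i-1}$. For $\varepsilon_g\in\mathbb R$, a mechanism $M$ and a class $\mathcal M$ put $$\delta_{\mathrm{opt}}(M;\varepsilon_g)=\inf\{\delta\ge 0: M\text{ is }(\varepsilon_g,\delta)\text{-DP}\},\qquad \delta_{\mathrm{opt}}(\mathcal M;\varepsilon_g)=\sup_{M\in\mathcal M}\delta_{\mathrm{opt}}(M;\varepsilon_g).$$ **Proposition.** Let $\varepsilon>0$ and $N\in\mathbb N$, and let $\mathcal A_1,\dots,\mathcal A_N$ and $\mathcal B_1,\dots,\mathcal B_N$ be such that, for some $k_{\mathcal A},k_{\mathcal B}\in\{1,\dots,N\}$, $\mathcal A_{k_{\mathcal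 A}}=\mathcal B_{k_{\mathcal B}}=\mathcal M_{\mathrm{BR}}(\varepsilon)$, while $\mathcal A_i=\mathcal M_{\mathrm{DP}}(\varepsilon)$ for all $i\ne k_{\mathcal A}$ and $\mathcal B_j=\mathcal M_{\mathrm{DP}}(\varepsilon)$ for all $j\ne k_{\mathcal B}$. Then for every $\varepsilon_g\in\mathbb R$ $$\delta_{\mathrm{opt}}\big((\mathcal A_1,\dots,\mathcal A_N);\varepsilon_g\big)=\delta_{\mathrm{opt}}\big((\mathcal B_1,\dots,\mathcal B_N);\varepsilon_g\big).$$ -/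

import Mathlib

open MeasureTheory ProbabilityTheory

universe u v

/-- A randomized algorithm from datasets `𝒳` to outcomes `Y`: it sends each dataset to the law
of its outcome. -/
abbrev Mechanism (𝒳 : Type u) (Y : Type v) [MeasurableSpace Y] : Type (max u v) :=
  𝒳 → ProbabilityMeasure Y

/-- A class of mechanisms on the datasets `𝒳`, with arbitrary measurable outcome spaces. -/
abbrev MechClass (𝒳 : Type u) : Type (max u (v + 1)) :=
  (Y : Type v) → [MeasurableSpace Y] → Set (Mechanism 𝒳 Y)

section Privacy

variable {𝒳 : Type u} (nbr : 𝒳 → 𝒳 → Prop)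

/-- `M` is `(ε, δ)`-differentially private for the neighbouring relation `nbr`. -/
def IsDP {Y : Type v} [MeasurableSpace Y] (M : Mechanism 𝒳 Y) (ε δ : ℝ) : Prop :=
  ∀ x x' : 𝒳, nbr x x' → ∀ S : Set Y, MeasurableSet S →
    (M x S : ℝ) ≤ Real.exp ε * (M x' S : ℝ) + δ

/-- `M` is `ε`-bounded range: for neighbours `x, x'`, any two values of the likelihood ratio of
`M x` to `M x'` differ by a factor of at most `exp ε`. The inequality
`P(S₁) / P'(S₁) ≤ exp ε * (P(S₂) / P'(S₂))` is written with the denominators cleared and for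
measurable events, so that it makes sense on outcome spaces where points have probability `0`;
when the outcome space is discrete it is equivalent to its restriction to one-point events. -/
def IsBR {Y : Type v} [MeasurableSpace Y] (M : Mechanism 𝒳 Y) (ε : ℝ) : Prop :=
  ∀ x x' : 𝒳, nbr x x' → ∀ S₁ S₂ : Set Y, MeasurableSet S₁ → MeasurableSet S₂ →
    (M x S₁ : ℝ) * (M x' S₂ : ℝ) ≤ Real.exp ε * ((M x S₂ : ℝ) * (M x' S₁ : ℝ))

/-- The class of all `ε`-DP mechanisms. -/
def classDP (ε : ℝ) : MechClass.{u, v} 𝒳 := fun _ _ => {M | IsDP nbr M ε 0}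

/-- The class of all `ε`-BR mechanisms. -/
def classBR (ε : ℝ) : MechClass.{u, v} 𝒳 := fun _ _ => {M | IsBR nbr M ε}

/-- `δ_opt(M; ε_g)`, the least `δ ≥ 0` for which `M` is `(ε_g, δ)`-DP (an infimum over a set that
contains `1` and is bounded below by `0`). -/
noncomputable def deltaOptMech {Y : Type v} [MeasurableSpace Y] (M : Mechanism 𝒳 Y) (εg : ℝ) : ℝ :=
  sInf {δ : ℝ | 0 ≤ δ ∧ IsDP nbr M εg δ}

/-- `δ_opt(𝓜; ε_g)`, the supremum of `δ_opt(M; ε_g)` over the mechanisms `M` of the class `𝓜`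
(all these numbers lie in `[0, 1]`). -/
noncomputable def deltaOpt (C : MechClass.{u, v} 𝒳) (εg : ℝ) : ℝ :=
  sSup {d : ℝ | ∃ (Y : Type v) (_ : MeasurableSpace Y), ∃ M ∈ C Y, d = deltaOptMech nbr M εg}

end Privacy

/-- The mechanism that is run when the history of earlier outcomes is `h`. -/
noncomputable def mechAt {𝒳 : Type u} {H Y : Type v} [MeasurableSpace H] [MeasurableSpace Y]
    (κ : 𝒳 → Kernel H Y) [∀ x, IsMarkovKernel (κ x)] (h : H) : Mechanism 𝒳 Y :=
  fun x => ⟨κ x h, inferInstance⟩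

/-- `IsAdaptiveRun Cs H R κ`: after a history in `H`, one runs one mechanism from each class of the
list `Cs`, in this order; each mechanism may depend (measurably) on the history and on all
outcomes obtained so far, and whatever these are it belongs to its class. `R` is the space of the
tuples of outcomes, and `κ x h` is the joint law of the outcomes on the dataset `x` after the
history `h`. -/
inductive IsAdaptiveRun {𝒳 : Type u} : List (MechClass.{u, v} 𝒳) →
    (H : Type v) → [MeasurableSpace H] → (R : Type v) → [MeasurableSpace R] →
    (𝒳 → Kernel H R) → Prop
  | nil (H : Type v) [MeasurableSpace H] :
      IsAdaptiveRun [] H PUnit.{v + 1} (fun _ => Kernel.const H (Measure.dirac PUnit.unit))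
  | cons (C : MechClass.{u, v} 𝒳) (Cs : List (MechClass.{u, v} 𝒳))
      (H Y R : Type v) [MeasurableSpace H] [MeasurableSpace Y] [MeasurableSpace R]
      (κ : 𝒳 → Kernel H Y) [∀ x, IsMarkovKernel (κ x)]
      (η : 𝒳 → Kernel (H × Y) R) [∀ x, IsMarkovKernel (η x)]
      (hκ : ∀ h : H, mechAt κ h ∈ C Y)
      (hη : IsAdaptiveRun Cs (H × Y) R η) :
      IsAdaptiveRun (C :: Cs) H (Y × R) (fun x => Kernel.compProd (κ x) (η x))

/-- `(𝓜₁, …, 𝓜ₖ)`: the class of the mechanisms that run adaptively selected mechanisms from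
`𝓜₁, …, 𝓜ₖ`, in this order, and output all the outcomes. -/
def adaptiveClass {𝒳 : Type u} (Cs : List (MechClass.{u, v} 𝒳)) : MechClass.{u, v} 𝒳 :=
  fun R _ => {M | ∃ κ : 𝒳 → Kernel PUnit.{v + 1} R,
    IsAdaptiveRun Cs PUnit.{v + 1} R κ ∧ ∀ x, (M x : Measure R) = κ x PUnit.unit}

/-!
The privacy profile of a pair of laws `P, Q` is `ρ ↦ sup_S (P S - ρ * Q S)`. Put `c = exp ε`. If a
mechanism whose likelihood ratios lie in `[lo, hi]` is run first, and what follows has profile at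
most `F`, then the profile of the composition is at most `chord lo hi F`, and a binary randomized
response attains this bound. For `ε`-DP mechanisms the interval is `[1 / c, c]`, for an `ε`-BR
mechanism it is `[t / c, t]` with some `t ∈ [1, c]`.

The operators `chord lo hi` commute, so the position of the `ε`-BR mechanism would not matter if `t`
were fixed in advance. A late `ε`-BR mechanism could however choose `t` according to the history.
This does not help: after `n` optimal `ε`-DP responses, `ρ` has become one of `ρ * c ^ (2 * k - n)`,
and `chord (t / c) t` changes the profile `max (1 - ρ) 0` of the empty composition only for `ρ` in
the interval `(1 / c, c)`, which contains at most one of these points. Hence the `t` that is best at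
that point is best at all of them.
-/

/-! ### Chord operators -/

section Chord

/-- The weight `w` for which `1 = w * hi + (1 - w) * lo`. -/
noncomputable def chordWeight (lo hi : ℝ) : ℝ := (1 - lo) / (hi - lo)

/-- The operator that sends `f` to the function whose value at `ρ` is the value at `ρ` of the chord
of `f` over `[ρ * lo, ρ * hi]`. It turns the privacy profile of the remaining runs into the one that
includes a run with likelihood ratios in `[lo, hi]`. -/
noncomputable def chord (lo hi : ℝ) (f : ℝ → ℝ) (ρ : ℝ) : ℝ :=
  chordWeight lo hi * f (ρ * hi) + (1 - chordWeight lo hi) * f (ρ * lo)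

/-- The chord operator of a run with likelihood ratios in `[c⁻¹, c]`, as for a `log c`-DP
mechanism. -/
noncomputable abbrev dpStep (c : ℝ) : (ℝ → ℝ) → ℝ → ℝ := chord c⁻¹ c

/-- The interval `[lo, hi]` is a possible range of the likelihood ratio of two probability
measures; degenerate intervals are excluded, so that `chordWeight lo hi` is meaningful. -/
structure IsRatioRange (lo hi : ℝ) : Prop where
  pos : 0 < lo
  lt : lo < hi
  le_one : lo ≤ 1
  one_le : 1 ≤ hi

theorem isRatioRange_inv {c : ℝ} (hc : 1 < c) : IsRatioRange c⁻¹ c where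
  pos := by positivity
  lt := (inv_lt_one_of_one_lt₀ hc).trans hc
  le_one := inv_le_one_of_one_le₀ hc.le
  one_le := hc.le

theorem isRatioRange_div {c t : ℝ} (hc : 1 < c) (ht : t ∈ Set.Icc 1 c) :
    IsRatioRange (t / c) t where
  pos := div_pos (by linarith [ht.1]) (by linarith)
  lt := div_lt_self (by linarith [ht.1]) hc
  le_one := div_le_one_of_le₀ ht.2 (by linarith)
  one_le := ht.1

variable {lo hi : ℝ}

namespace IsRatioRange

theorem pos_right (h : IsRatioRange lo hi) : 0 < hi := h.pos.trans h.lt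

theorem chordWeight_nonneg (h : IsRatioRange lo hi) : 0 ≤ chordWeight lo hi :=
  div_nonneg (sub_nonneg.2 h.le_one) (sub_pos.2 h.lt).le

theorem chordWeight_le_one (h : IsRatioRange lo hi) : chordWeight lo hi ≤ 1 :=
  div_le_one_of_le₀ (by linarith [h.one_le]) (sub_pos.2 h.lt).le

theorem one_sub_mul_chordWeight (h : IsRatioRange lo hi) :
    1 - hi * chordWeight lo hi = lo * (1 - chordWeight lo hi) := by
  have := (sub_pos.2 h.lt).ne'
  unfold chordWeight
  field_simp
  ring

theorem mul_chordWeight_le_one (h : IsRatioRange lo hi) : hi * chordWeight lo hi ≤ 1 := by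
  have := mul_nonneg h.pos.le (sub_nonneg.2 h.chordWeight_le_one)
  linarith [h.one_sub_mul_chordWeight]

theorem chord_monotone (h : IsRatioRange lo hi) : Monotone (chord lo hi) := fun _ _ hfg _ =>
  add_le_add (mul_le_mul_of_nonneg_left (hfg _) h.chordWeight_nonneg)
    (mul_le_mul_of_nonneg_left (hfg _) (sub_nonneg.2 h.chordWeight_le_one))

end IsRatioRange

theorem chord_commute (lo hi lo' hi' : ℝ) : Function.Commute (chord lo hi) (chord lo' hi') := by
  intro f
  funext ρ
  simp only [chord, mul_right_comm ρ _ hi, mul_right_comm ρ _ lo]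
  ring

theorem dpStep_iterate_eq_of_progression {c : ℝ} (hc : c ≠ 0) {f g : ℝ → ℝ} (n : ℕ) {ρ : ℝ}
    (h : ∀ k : ℤ, f (ρ * c ^ (2 * k - n)) = g (ρ * c ^ (2 * k - n))) :
    (dpStep c)^[n] f ρ = (dpStep c)^[n] g ρ := by
  induction n generalizing ρ with
  | zero => simpa using h 0
  | succ n ih =>
    have shift_up (k : ℤ) : ρ * c * c ^ (2 * k - n) = ρ * c ^ (2 * (k + 1) - (n + 1 : ℕ)) := by
      rw [mul_assoc, ← zpow_one_add₀ hc]
      congr 2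
      push_cast
      ring
    have shift_down (k : ℤ) : ρ * c⁻¹ * c ^ (2 * k - n) = ρ * c ^ (2 * k - (n + 1 : ℕ)) := by
      rw [mul_assoc, ← zpow_neg_one, ← zpow_add₀ hc]
      congr 2
      push_cast
      ring
    rw [Function.iterate_succ_apply', Function.iterate_succ_apply', dpStep, chord, chord,
      ih fun k => by rw [shift_up]; exact h (k + 1), ih fun k => by rw [shift_down]; exact h k]

end Chord

section Hockey

/-- The privacy profile of the empty composition. -/
noncomputable def hockey (ρ : ℝ) : ℝ := max (1 - ρ) 0

theorem chord_hockey_of_notMem {lo hi ρ : ℝ} (h : IsRatioRange lo hi) (hρ : 0 ≤ ρ)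
    (hmem : 1 ∉ Set.Ioo (ρ * lo) (ρ * hi)) : chord lo hi hockey ρ = hockey ρ := by
  have hlo : ρ * lo ≤ ρ := mul_le_of_le_one_right hρ h.le_one
  have hhi : ρ ≤ ρ * hi := le_mul_of_one_le_right hρ h.one_le
  unfold chord hockey
  by_cases hlt : ρ * lo < 1
  · have hle : ρ * hi ≤ 1 := not_lt.1 fun hgt => hmem ⟨hlt, hgt⟩
    rw [max_eq_left (by linarith), max_eq_left (by linarith), max_eq_left (by linarith)]
    linear_combination ρ * h.one_sub_mul_chordWeight
  · rw [max_eq_right (by linarith), max_eq_right (by linarith), max_eq_right (by linarith)]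
    ring

/-- The privacy profile of the best single run with likelihood ratios in one of the intervals
`[t / c, t]`, `1 ≤ t ≤ c`, as for a `log c`-BR mechanism. -/
noncomputable def brProfile (c ρ : ℝ) : ℝ :=
  sSup ((fun t => chord (t / c) t hockey ρ) '' Set.Icc 1 c)

variable {c : ℝ}

theorem continuousOn_chord_div_hockey (hc : 1 < c) (ρ : ℝ) :
    ContinuousOn (fun t => chord (t / c) t hockey ρ) (Set.Icc 1 c) := by
  have hden : ∀ t ∈ Set.Icc 1 c, t - t / c ≠ 0 := fun t ht =>
    (sub_pos.2 (isRatioRange_div hc ht).lt).ne'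
  unfold chord chordWeight hockey
  fun_prop (disch := exact hden)

theorem chord_div_hockey_le_brProfile (hc : 1 < c) {t : ℝ} (ht : t ∈ Set.Icc 1 c) :
    chord (t / c) t hockey ≤ brProfile c := fun ρ =>
  le_csSup (isCompact_Icc.bddAbove_image (continuousOn_chord_div_hockey hc ρ)) ⟨t, ht, rfl⟩

theorem exists_brProfile_eq (hc : 1 < c) (ρ : ℝ) :
    ∃ t ∈ Set.Icc 1 c, brProfile c ρ = chord (t / c) t hockey ρ :=
  isCompact_Icc.exists_sSup_image_eq (Set.nonempty_Icc.2 hc.le)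
    (continuousOn_chord_div_hockey hc ρ)

theorem chord_div_hockey_of_notMem (hc : 1 < c) {t ρ : ℝ} (ht : t ∈ Set.Icc 1 c) (hρ : 0 ≤ ρ)
    (hmem : ρ ∉ Set.Ioo c⁻¹ c) : chord (t / c) t hockey ρ = hockey ρ := by
  have hc0 : 0 < c := by linarith
  refine chord_hockey_of_notMem (isRatioRange_div hc ht) hρ fun ⟨hlt, hgt⟩ => hmem ⟨?_, ?_⟩
  · rw [inv_lt_iff_one_lt_mul₀ hc0]
    exact hgt.trans_le (mul_le_mul_of_nonneg_left ht.2 hρ)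
  · rw [mul_div_assoc', div_lt_one hc0] at hlt
    exact (le_mul_of_one_le_right hρ ht.1).trans_lt hlt

theorem brProfile_eq_of_notMem (hc : 1 < c) {t ρ : ℝ} (ht : t ∈ Set.Icc 1 c) (hρ : 0 ≤ ρ)
    (hmem : ρ ∉ Set.Ioo c⁻¹ c) : brProfile c ρ = chord (t / c) t hockey ρ := by
  obtain ⟨t', ht', heq⟩ := exists_brProfile_eq hc ρ
  rw [heq, chord_div_hockey_of_notMem hc ht' hρ hmem, chord_div_hockey_of_notMem hc ht hρ hmem]

theorem progression_mem_Ioo_unique (hc : 1 < c) {ρ : ℝ} (hρ : 0 < ρ) {n j k : ℤ}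
    (hj : ρ * c ^ (2 * j - n) ∈ Set.Ioo c⁻¹ c) (hk : ρ * c ^ (2 * k - n) ∈ Set.Ioo c⁻¹ c) :
    j = k := by
  wlog hjk : j < k generalizing j k
  · exact (not_lt.1 hjk).eq_or_lt.elim Eq.symm fun hkj => (this hk hj hkj).symm
  have hc0 : 0 < c := by linarith
  have : c < ρ * c ^ (2 * k - n) :=
    calc c = c⁻¹ * c ^ 2 := by field_simp
      _ < ρ * c ^ (2 * j - n) * c ^ 2 := mul_lt_mul_of_pos_right hj.1 (by positivity)
      _ = ρ * c ^ (2 * j - n + 2) := by rw [zpow_add₀ hc0.ne', zpow_ofNat, mul_assoc]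
      _ ≤ ρ * c ^ (2 * k - n) := by gcongr; exacts [hc.le, by omega]
  exact absurd hk.2 this.not_gt

theorem exists_brProfile_eq_on_progression (hc : 1 < c) {ρ : ℝ} (hρ : 0 < ρ) (n : ℤ) :
    ∃ t ∈ Set.Icc 1 c, ∀ k : ℤ,
      brProfile c (ρ * c ^ (2 * k - n)) = chord (t / c) t hockey (ρ * c ^ (2 * k - n)) := by
  have hpos (k : ℤ) : 0 ≤ ρ * c ^ (2 * k - n) :=
    mul_nonneg hρ.le (zpow_nonneg (zero_le_one.trans hc.le) _)
  by_cases hmem : ∃ k : ℤ, ρ * c ^ (2 * k - n) ∈ Set.Ioo c⁻¹ c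
  · obtain ⟨k, hk⟩ := hmem
    obtain ⟨t, ht, heq⟩ := exists_brProfile_eq hc (ρ * c ^ (2 * k - n))
    refine ⟨t, ht, fun j => ?_⟩
    by_cases hj : ρ * c ^ (2 * j - n) ∈ Set.Ioo c⁻¹ c
    · rwa [progression_mem_Ioo_unique hc hρ hj hk]
    · exact brProfile_eq_of_notMem hc ht (hpos j) hj
  · have h1 : (1 : ℝ) ∈ Set.Icc 1 c := ⟨le_rfl, hc.le⟩
    exact ⟨1, h1, fun k => brProfile_eq_of_notMem hc h1 (hpos k) (not_exists.1 hmem k)⟩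

theorem exists_dpStep_iterate_brProfile_eq (hc : 1 < c) {ρ : ℝ} (hρ : 0 < ρ) (n : ℕ) :
    ∃ t ∈ Set.Icc 1 c,
      (dpStep c)^[n] (brProfile c) ρ = (dpStep c)^[n] (chord (t / c) t hockey) ρ := by
  obtain ⟨t, ht, heq⟩ := exists_brProfile_eq_on_progression hc hρ n
  exact ⟨t, ht, dpStep_iterate_eq_of_progression (by linarith) n heq⟩

end Hockey

/-! ### Likelihood ratios and privacy profiles of pairs of laws -/

section Ratio

variable {Y : Type*} [MeasurableSpace Y] {P Q : Measure Y} {lo hi : ℝ}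

/-- The likelihood ratio of `Q` to `P` takes values in `[lo, hi]`. It is expressed through the
measures of events, so that no density is needed. -/
def HasRatioIn (P Q : Measure Y) (lo hi : ℝ) : Prop :=
  ∀ S, MeasurableSet S → lo * P.real S ≤ Q.real S ∧ Q.real S ≤ hi * P.real S

namespace HasRatioIn

theorem symm (h : HasRatioIn P Q lo hi) (hlo : 0 < lo) (hhi : 0 < hi) :
    HasRatioIn Q P hi⁻¹ lo⁻¹ := fun S hS =>
  ⟨(inv_mul_le_iff₀ hhi).2 (h S hS).2, (le_inv_mul_iff₀ hlo).2 (h S hS).1⟩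

theorem le_smul [IsFiniteMeasure P] [IsFiniteMeasure Q] (h : HasRatioIn P Q lo hi) (hhi : 0 ≤ hi) :
    Q ≤ ENNReal.ofReal hi • P := by
  refine Measure.le_iff.2 fun S hS => ?_
  rw [Measure.smul_apply, smul_eq_mul, ← ofReal_measureReal (μ := P), ← ENNReal.ofReal_mul hhi,
    ← ofReal_measureReal (μ := Q)]
  exact ENNReal.ofReal_le_ofReal (h S hS).2

theorem integrable [IsFiniteMeasure P] [IsFiniteMeasure Q] (h : HasRatioIn P Q lo hi)
    (hhi : 0 ≤ hi) {f : Y → ℝ} (hf : Integrable f P) : Integrable f Q :=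
  hf.of_measure_le_smul ENNReal.ofReal_ne_top (h.le_smul hhi)

theorem integral_le_mul_integral [IsFiniteMeasure P] [IsFiniteMeasure Q]
    (h : HasRatioIn P Q lo hi) (hhi : 0 ≤ hi) {f : Y → ℝ} (hf : Integrable f P) (hf0 : 0 ≤ f) :
    ∫ y, f y ∂Q ≤ hi * ∫ y, f y ∂P := by
  calc ∫ y, f y ∂Q ≤ ∫ y, f y ∂(ENNReal.ofReal hi • P) :=
        integral_mono_measure (h.le_smul hhi) (ae_of_all _ hf0)
          (hf.smul_measure ENNReal.ofReal_ne_top)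
    _ = hi * ∫ y, f y ∂P := by
        rw [integral_smul_measure, ENNReal.toReal_ofReal hhi, smul_eq_mul]

theorem mul_integral_le_integral [IsFiniteMeasure P] [IsFiniteMeasure Q]
    (h : HasRatioIn P Q lo hi) (hlo : 0 < lo) (hhi : 0 < hi) {f : Y → ℝ} (hf : Integrable f P)
    (hf0 : 0 ≤ f) : lo * ∫ y, f y ∂P ≤ ∫ y, f y ∂Q :=
  (le_inv_mul_iff₀ hlo).1 <|
    (h.symm hlo hhi).integral_le_mul_integral (inv_nonneg.2 hlo.le) (h.integrable hhi.le hf) hf0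

theorem integral_sub_mul_integral_le_chord [IsProbabilityMeasure P] [IsProbabilityMeasure Q]
    (h : HasRatioIn P Q lo hi) (hr : IsRatioRange lo hi) {φ ψ : Y → ℝ} (hφ : Integrable φ P)
    (hψ : Integrable ψ P) {F : ℝ → ℝ} {ρ : ℝ} (hFhi : ∀ y, φ y - ρ * hi * ψ y ≤ F (ρ * hi))
    (hFlo : ∀ y, φ y - ρ * lo * ψ y ≤ F (ρ * lo)) :
    ∫ y, φ y ∂P - ρ * ∫ y, ψ y ∂Q ≤ chord lo hi F ρ := by
  have hhi := hr.pos_right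
  have hint (a b : ℝ) : Integrable (fun y => b - (φ y - a * ψ y)) P :=
    (integrable_const b).sub (hφ.sub (hψ.const_mul a))
  have heval (μ : Measure Y) [IsProbabilityMeasure μ] (hφ : Integrable φ μ) (hψ : Integrable ψ μ)
      (a b : ℝ) :
      ∫ y, (b - (φ y - a * ψ y)) ∂μ = b - (∫ y, φ y ∂μ - a * ∫ y, ψ y ∂μ) := by
    have hsub : Integrable (fun y => φ y - a * ψ y) μ := hφ.sub (hψ.const_mul a)
    rw [integral_sub (integrable_const b) hsub, integral_sub hφ (hψ.const_mul a),
      integral_const_mul, integral_const, probReal_univ, one_smul]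
  -- `(hi - lo) * (P φ - ρ * Q ψ)` equals
  -- `(Q - lo * P) (φ - ρ * hi * ψ) + (hi * P - Q) (φ - ρ * lo * ψ)`, and `Q - lo * P` and
  -- `hi * P - Q` are nonnegative.
  have hlower := h.mul_integral_le_integral hr.pos hhi (hint (ρ * hi) (F (ρ * hi)))
    fun y => sub_nonneg.2 (hFhi y)
  have hupper := h.integral_le_mul_integral hhi.le (hint (ρ * lo) (F (ρ * lo)))
    fun y => sub_nonneg.2 (hFlo y)
  rw [heval P hφ hψ, heval Q (h.integrable hhi.le hφ) (h.integrable hhi.le hψ)] at hlower hupper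
  have hd := sub_pos.2 hr.lt
  have hchord : chord lo hi F ρ =
      ((1 - lo) * F (ρ * hi) + (hi - 1) * F (ρ * lo)) / (hi - lo) := by
    unfold chord chordWeight
    field_simp
    ring
  rw [hchord, le_div_iff₀ hd]
  linarith

end HasRatioIn

theorem HasRatioIn.mul_le_mul {c t : ℝ} (hc : 0 < c) (h : HasRatioIn P Q (t / c) t) {S₁ S₂ : Set Y}
    (hS₁ : MeasurableSet S₁) (hS₂ : MeasurableSet S₂) :
    P.real S₁ * Q.real S₂ ≤ c * (P.real S₂ * Q.real S₁) :=
  calc P.real S₁ * Q.real S₂ ≤ P.real S₁ * (t * P.real S₂) := by gcongr; exact (h S₂ hS₂).2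
    _ = c * (P.real S₂ * (t / c * P.real S₁)) := by field_simp
    _ ≤ c * (P.real S₂ * Q.real S₁) := by gcongr; exact (h S₁ hS₁).1

theorem exists_hasRatioIn_of_mul_le_mul [IsProbabilityMeasure P] [IsProbabilityMeasure Q] {c : ℝ}
    (hc : 0 < c) (h : ∀ S₁ S₂, MeasurableSet S₁ → MeasurableSet S₂ →
      P.real S₁ * Q.real S₂ ≤ c * (P.real S₂ * Q.real S₁)) :
    ∃ t ∈ Set.Icc 1 c, HasRatioIn P Q (t / c) t := by
  have hle (S : Set Y) (hS : MeasurableSet S) : Q.real S ≤ c * P.real S := by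
    simpa using h Set.univ S .univ hS
  set ratios : Set ℝ := {r | ∃ S, MeasurableSet S ∧ 0 < P.real S ∧ Q.real S / P.real S = r}
  have hone : 1 ∈ ratios := ⟨Set.univ, .univ, by simp, by simp⟩
  have hupper : c ∈ upperBounds ratios := by
    rintro _ ⟨S, hS, hpos, rfl⟩
    exact (div_le_iff₀ hpos).2 (hle S hS)
  refine ⟨sSup ratios, ⟨le_csSup ⟨c, hupper⟩ hone, csSup_le ⟨1, hone⟩ hupper⟩, fun S hS => ?_⟩
  rcases (measureReal_nonneg (μ := P) (s := S)).eq_or_lt with hzero | hpos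
  · simpa [← hzero] using hle S hS
  refine ⟨?_, (div_le_iff₀ hpos).1 (le_csSup ⟨c, hupper⟩ ⟨S, hS, hpos, rfl⟩)⟩
  rw [← le_div_iff₀ hpos, div_le_iff₀ hc]
  refine csSup_le ⟨1, hone⟩ ?_
  rintro _ ⟨T, hT, hposT, rfl⟩
  rw [div_le_iff₀ hposT, div_mul_eq_mul_div, div_mul_eq_mul_div, le_div_iff₀ hpos]
  linarith [h S T hS hT]

end Ratio

section Profile

variable {Y R : Type*} [MeasurableSpace Y] [MeasurableSpace R] {P Q : Measure Y}
  {η η' : Kernel Y R} {F : ℝ → ℝ} {lo hi : ℝ}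

theorem measureReal_compProd_apply [SFinite P] [IsFiniteKernel η] {S : Set (Y × R)}
    (hS : MeasurableSet S) : (P ⊗ₘ η).real S = ∫ y, (η y).real (Prod.mk y ⁻¹' S) ∂P := by
  have hmeas := (Kernel.measurable_kernel_prodMk_left (κ := η) hS).aemeasurable (μ := P)
  rw [measureReal_def, Measure.compProd_apply hS,
    ← integral_toReal hmeas (ae_of_all _ fun _ => measure_lt_top _ _)]
  rfl

theorem integrable_measureReal_prodMk_preimage [IsFiniteMeasure P] [IsFiniteKernel η]
    {S : Set (Y × R)} (hS : MeasurableSet S) :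
    Integrable (fun y => (η y).real (Prod.mk y ⁻¹' S)) P :=
  integrable_toReal_of_lintegral_ne_top (Kernel.measurable_kernel_prodMk_left hS).aemeasurable
    (Measure.compProd_apply (μ := P) (κ := η) hS ▸ measure_ne_top _ _)

/-- The privacy profile `ρ ↦ sup_S (P S - ρ * Q S)` of the pair `P, Q` is at most `F`. At
`ρ = exp ε` this is the inequality of `(ε, F ρ)`-differential privacy. -/
def ProfileLE (P Q : Measure Y) (F : ℝ → ℝ) : Prop :=
  ∀ ρ S, MeasurableSet S → P.real S - ρ * Q.real S ≤ F ρ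

/-- The privacy profile `ρ ↦ sup_S (P S - ρ * Q S)` of the pair `P, Q` is at least `F`, with an
event as witness at every `ρ`. -/
def ProfileAttains (P Q : Measure Y) (F : ℝ → ℝ) : Prop :=
  ∀ ρ, ∃ S, MeasurableSet S ∧ F ρ ≤ P.real S - ρ * Q.real S

theorem profileLE_self [IsProbabilityMeasure P] : ProfileLE P P hockey := fun ρ S _ => by
  have hle : P.real S ≤ 1 := measureReal_le_one
  rw [← one_sub_mul]
  rcases le_total ρ 1 with hρ | hρ
  · exact (mul_le_of_le_one_right (sub_nonneg.2 hρ) hle).trans (le_max_left _ _)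
  · exact (mul_nonpos_of_nonpos_of_nonneg (sub_nonpos.2 hρ) measureReal_nonneg).trans
      (le_max_right _ _)

theorem profileAttains_hockey [IsProbabilityMeasure P] [IsProbabilityMeasure Q] :
    ProfileAttains P Q hockey := fun ρ => by
  rcases le_total ρ 1 with hρ | hρ
  · exact ⟨Set.univ, .univ, by simp [hockey, hρ]⟩
  · exact ⟨∅, .empty, by simp [hockey, hρ]⟩

theorem ProfileLE.mono {G : ℝ → ℝ} (h : ProfileLE P Q F) (hFG : F ≤ G) : ProfileLE P Q G :=
  fun ρ S hS => (h ρ S hS).trans (hFG ρ)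

theorem ProfileLE.compProd [IsProbabilityMeasure P] [IsProbabilityMeasure Q] [IsFiniteKernel η]
    [IsFiniteKernel η'] (hr : IsRatioRange lo hi) (hPQ : HasRatioIn P Q lo hi)
    (hη : ∀ y, ProfileLE (η y) (η' y) F) : ProfileLE (P ⊗ₘ η) (Q ⊗ₘ η') (chord lo hi F) := by
  intro ρ S hS
  rw [measureReal_compProd_apply hS, measureReal_compProd_apply hS]
  exact hPQ.integral_sub_mul_integral_le_chord hr (integrable_measureReal_prodMk_preimage hS)
    (integrable_measureReal_prodMk_preimage hS) (fun y => hη y _ _ (measurable_prodMk_left hS))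
    fun y => hη y _ _ (measurable_prodMk_left hS)

end Profile

/-! ### Binary randomized response -/

section Response

variable {lo hi : ℝ}

namespace IsRatioRange

/-- The probability of the answer `true`, the outcome with likelihood ratio `hi`, under the first
of the two laws of the binary response with likelihood ratios `lo` and `hi`. -/
noncomputable def firstProb (h : IsRatioRange lo hi) : unitInterval :=
  ⟨chordWeight lo hi, h.chordWeight_nonneg, h.chordWeight_le_one⟩

/-- The probability of the answer `true` under the second law of the binary response. -/
noncomputable def secondProb (h : IsRatioRange lo hi) : unitInterval :=
  ⟨hi * chordWeight lo hi, mul_nonneg h.pos_right.le h.chordWeight_nonneg,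
    h.mul_chordWeight_le_one⟩

end IsRatioRange

/-- The law of an answer that is `true` with probability `p`; the answers are lifted to the universe
of the outcome spaces. -/
noncomputable def answerLaw (p : unitInterval) : ProbabilityMeasure (ULift.{v} Bool) :=
  ⟨bernoulliMeasure ⟨true⟩ ⟨false⟩ p, inferInstance⟩

theorem integral_answerLaw (p : unitInterval) (f : ULift.{v} Bool → ℝ) :
    ∫ b, f b ∂(answerLaw p : Measure (ULift.{v} Bool)) = p * f ⟨true⟩ + (1 - p) * f ⟨false⟩ :=
  integral_bernoulliMeasure _ _ p f

theorem measureReal_answerLaw (p : unitInterval) (S : Set (ULift.{v} Bool)) :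
    (answerLaw p : Measure (ULift.{v} Bool)).real S =
      p * S.indicator 1 ⟨true⟩ + (1 - p) * S.indicator 1 ⟨false⟩ := by
  rw [← integral_answerLaw, integral_indicator_one .of_discrete]

theorem IsRatioRange.hasRatioIn_answerLaw (h : IsRatioRange lo hi) :
    HasRatioIn (answerLaw.{v} h.firstProb : Measure (ULift.{v} Bool)) (answerLaw h.secondProb)
      lo hi := by
  intro S _
  have htrue : 0 ≤ chordWeight lo hi * S.indicator (1 : ULift.{v} Bool → ℝ) ⟨true⟩ :=
    mul_nonneg h.chordWeight_nonneg (Set.indicator_nonneg (by simp) _)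
  have hfalse : 0 ≤ (1 - chordWeight lo hi) * S.indicator (1 : ULift.{v} Bool → ℝ) ⟨false⟩ :=
    mul_nonneg (sub_nonneg.2 h.chordWeight_le_one) (Set.indicator_nonneg (by simp) _)
  simp only [measureReal_answerLaw, IsRatioRange.firstProb, IsRatioRange.secondProb,
    h.one_sub_mul_chordWeight]
  constructor <;> linarith [mul_le_mul_of_nonneg_right h.lt.le htrue,
    mul_le_mul_of_nonneg_right h.lt.le hfalse]

theorem ProfileAttains.answerLaw_compProd {R : Type*} [MeasurableSpace R]
    {η η' : Kernel (ULift.{v} Bool) R} [IsFiniteKernel η] [IsFiniteKernel η'] {F : ℝ → ℝ}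
    (hr : IsRatioRange lo hi) (hη : ∀ b, ProfileAttains (η b) (η' b) F) :
    ProfileAttains ((answerLaw hr.firstProb : Measure (ULift.{v} Bool)) ⊗ₘ η)
      ((answerLaw hr.secondProb : Measure (ULift.{v} Bool)) ⊗ₘ η') (chord lo hi F) := by
  intro ρ
  obtain ⟨T, hT, hle_true⟩ := hη ⟨true⟩ (ρ * hi)
  obtain ⟨U, hU, hle_false⟩ := hη ⟨false⟩ (ρ * lo)
  let S : Set (ULift.{v} Bool × R) := {⟨true⟩} ×ˢ T ∪ {⟨false⟩} ×ˢ U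
  have hS : MeasurableSet S :=
    (MeasurableSet.of_discrete.prod hT).union (MeasurableSet.of_discrete.prod hU)
  refine ⟨S, hS, ?_⟩
  have hpre_true : Prod.mk ⟨true⟩ ⁻¹' S = T := by ext; simp [S]
  have hpre_false : Prod.mk ⟨false⟩ ⁻¹' S = U := by ext; simp [S]
  rw [measureReal_compProd_apply hS, measureReal_compProd_apply hS, integral_answerLaw,
    integral_answerLaw]
  simp only [hpre_true, hpre_false, IsRatioRange.firstProb, IsRatioRange.secondProb,
    hr.one_sub_mul_chordWeight, chord]
  linarith [mul_le_mul_of_nonneg_left hle_true hr.chordWeight_nonneg,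
    mul_le_mul_of_nonneg_left hle_false (sub_nonneg.2 hr.chordWeight_le_one)]

variable {𝒳 : Type u}

open scoped Classical in
/-- The binary response that tells the dataset `x` from all the others, with likelihood ratios
`lo` and `hi`. -/
noncomputable def response (x : 𝒳) (h : IsRatioRange lo hi) : Mechanism 𝒳 (ULift.{v} Bool) :=
  fun z => if z = x then answerLaw h.firstProb else answerLaw h.secondProb

theorem response_self (x : 𝒳) (h : IsRatioRange lo hi) :
    response.{u, v} x h x = answerLaw h.firstProb :=
  if_pos rfl

theorem response_of_ne {x x' : 𝒳} (hx : x' ≠ x) (h : IsRatioRange lo hi) :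
    response.{u, v} x h x' = answerLaw h.secondProb :=
  if_neg hx

theorem response_rel
    {r : ProbabilityMeasure (ULift.{v} Bool) → ProbabilityMeasure (ULift.{v} Bool) → Prop}
    (h : IsRatioRange lo hi) (hrefl : ∀ P, r P P)
    (hfst : r (answerLaw h.firstProb) (answerLaw h.secondProb))
    (hsnd : r (answerLaw h.secondProb) (answerLaw h.firstProb)) (x z z' : 𝒳) :
    r (response x h z) (response x h z') := by
  unfold response
  split_ifs
  exacts [hrefl _, hfst, hsnd, hrefl _]

end Response

/-! ### Mechanisms and adaptive runs -/

section Mechanism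

variable {𝒳 : Type u} {nbr : 𝒳 → 𝒳 → Prop} {ε : ℝ}

theorem IsDP.hasRatioIn {Y : Type v} [MeasurableSpace Y] {M : Mechanism 𝒳 Y}
    (hM : IsDP nbr M ε 0) {x x' : 𝒳} (hx : nbr x x') (hx' : nbr x' x) :
    HasRatioIn (M x : Measure Y) (M x') (Real.exp ε)⁻¹ (Real.exp ε) := fun S hS => by
  have hle := hM x x' hx S hS
  have hge := hM x' x hx' S hS
  simp only [add_zero, ← ProbabilityMeasure.measureReal_eq_coe_coeFn] at hle hge
  exact ⟨(inv_mul_le_iff₀ (Real.exp_pos ε)).2 hle, hge⟩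

theorem IsBR.exists_hasRatioIn {Y : Type v} [MeasurableSpace Y] {M : Mechanism 𝒳 Y}
    (hM : IsBR nbr M ε) {x x' : 𝒳} (hx : nbr x x') :
    ∃ t ∈ Set.Icc 1 (Real.exp ε), HasRatioIn (M x : Measure Y) (M x') (t / Real.exp ε) t :=
  exists_hasRatioIn_of_mul_le_mul (Real.exp_pos ε) fun S₁ S₂ hS₁ hS₂ => by
    simpa only [ProbabilityMeasure.measureReal_eq_coe_coeFn] using hM x x' hx S₁ S₂ hS₁ hS₂

theorem isDP_response (nbr : 𝒳 → 𝒳 → Prop) (x : 𝒳) (hε : 0 < ε) :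
    IsDP nbr (response.{u, v} x (isRatioRange_inv (Real.one_lt_exp_iff.2 hε))) ε 0 := by
  intro z z' _ S hS
  have hratio := (isRatioRange_inv (Real.one_lt_exp_iff.2 hε)).hasRatioIn_answerLaw.{v} S hS
  simp only [add_zero, ← ProbabilityMeasure.measureReal_eq_coe_coeFn]
  exact response_rel (r := fun P Q => (P : Measure _).real S ≤ Real.exp ε * (Q : Measure _).real S)
    _ (fun P => le_mul_of_one_le_left measureReal_nonneg (Real.one_le_exp hε.le))
    ((inv_mul_le_iff₀ (Real.exp_pos ε)).1 hratio.1) hratio.2 x z z'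

theorem isBR_response (nbr : 𝒳 → 𝒳 → Prop) (x : 𝒳) (hε : 0 < ε) {t : ℝ}
    (ht : t ∈ Set.Icc 1 (Real.exp ε)) :
    IsBR nbr (response.{u, v} x (isRatioRange_div (Real.one_lt_exp_iff.2 hε) ht)) ε := by
  intro z z' _ S₁ S₂ hS₁ hS₂
  have hratio := (isRatioRange_div (Real.one_lt_exp_iff.2 hε) ht).hasRatioIn_answerLaw.{v}
  simp only [← ProbabilityMeasure.measureReal_eq_coe_coeFn]
  refine response_rel (r := fun P Q => (P : Measure _).real S₁ * (Q : Measure _).real S₂ ≤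
    Real.exp ε * ((P : Measure _).real S₂ * (Q : Measure _).real S₁)) _ (fun P => ?_)
    (hratio.mul_le_mul (Real.exp_pos ε) hS₁ hS₂) ?_ x z z'
  · rw [mul_comm ((P : Measure _).real S₂)]
    exact le_mul_of_one_le_left (by positivity) (Real.one_le_exp hε.le)
  · linarith [hratio.mul_le_mul (Real.exp_pos ε) hS₂ hS₁]

end Mechanism

section Run

variable {𝒳 : Type u} {nbr : 𝒳 → 𝒳 → Prop} {x x' : 𝒳} {C : MechClass.{u, v} 𝒳}
  {Cs : List (MechClass.{u, v} 𝒳)} {F : ℝ → ℝ} {ε : ℝ}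

theorem IsAdaptiveRun.isMarkovKernel {H R : Type v} [MeasurableSpace H] [MeasurableSpace R]
    {κ : 𝒳 → Kernel H R} (h : IsAdaptiveRun Cs H R κ) (x : 𝒳) : IsMarkovKernel (κ x) := by
  induction h <;> infer_instance

/-- Every adaptive run of `Cs` has privacy profile at most `F` on the pair of datasets `x, x'`,
after every history. -/
def RunProfileLE (x x' : 𝒳) (Cs : List (MechClass.{u, v} 𝒳)) (F : ℝ → ℝ) : Prop :=
  ∀ ⦃H R : Type v⦄ [MeasurableSpace H] [MeasurableSpace R] ⦃κ : 𝒳 → Kernel H R⦄,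
    IsAdaptiveRun Cs H R κ → ∀ h, ProfileLE (κ x h) (κ x' h) F

theorem runProfileLE_self (x : 𝒳) (Cs : List (MechClass.{u, v} 𝒳)) : RunProfileLE x x Cs hockey :=
  fun _ _ _ _ _ hκ _ =>
    have := hκ.isMarkovKernel x
    profileLE_self

theorem runProfileLE_nil (x x' : 𝒳) : RunProfileLE.{u, v} x x' [] hockey := by
  intro H R _ _ κ hκ h
  cases hκ
  simpa only [Kernel.const_apply] using profileLE_self

theorem RunProfileLE.cons {G : ℝ → ℝ}
    (hC : ∀ (Y : Type v) [MeasurableSpace Y], ∀ M ∈ C Y, ∃ lo hi, IsRatioRange lo hi ∧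
      HasRatioIn (M x : Measure Y) (M x') lo hi ∧ chord lo hi F ≤ G)
    (hCs : RunProfileLE x x' Cs F) : RunProfileLE x x' (C :: Cs) G := by
  intro H R _ _ κ hκ h
  cases hκ with
  | cons _ _ _ Y R κ η hκ hη =>
    have := hη.isMarkovKernel
    obtain ⟨lo, hi, hr, hratio, hle⟩ := hC Y _ (hκ h)
    rw [Kernel.compProd_apply_eq_compProd_sectR, Kernel.compProd_apply_eq_compProd_sectR]
    exact (ProfileLE.compProd hr hratio fun y => hCs hη (h, y)).mono hle

theorem RunProfileLE.replicate_append (hε : 0 < ε) (hx : nbr x x') (hx' : nbr x' x)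
    (hCs : RunProfileLE x x' Cs F) (n : ℕ) :
    RunProfileLE x x' (List.replicate n (classDP nbr ε) ++ Cs) ((dpStep (Real.exp ε))^[n] F) := by
  induction n with
  | zero => exact hCs
  | succ n ih =>
    rw [Function.iterate_succ_apply']
    exact ih.cons fun Y _ M hM => ⟨_, _, isRatioRange_inv (Real.one_lt_exp_iff.2 hε),
      IsDP.hasRatioIn hM hx hx', le_rfl⟩

/-- After every history, some adaptive run of `Cs` has privacy profile at least `F` on all pairs of
datasets `x, x'` with `x' ≠ x`. -/
def RunProfileAttained (x : 𝒳) (Cs : List (MechClass.{u, v} 𝒳)) (F : ℝ → ℝ) : Prop :=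
  ∀ (H : Type v) [MeasurableSpace H], ∃ (R : Type v) (_ : MeasurableSpace R)
    (κ : 𝒳 → Kernel H R), IsAdaptiveRun Cs H R κ ∧
      ∀ x' ≠ x, ∀ h, ProfileAttains (κ x h) (κ x' h) F

theorem runProfileAttained_nil (x : 𝒳) : RunProfileAttained.{u, v} x [] hockey := fun H _ =>
  ⟨_, _, _, .nil H, fun _ _ _ => by simpa only [Kernel.const_apply] using profileAttains_hockey⟩

theorem RunProfileAttained.cons {lo hi : ℝ} (hr : IsRatioRange lo hi)
    (hC : response x hr ∈ C (ULift.{v} Bool)) (hCs : RunProfileAttained x Cs F) :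
    RunProfileAttained x (C :: Cs) (chord lo hi F) := by
  intro H _
  obtain ⟨R, _, η, hη, hval⟩ := hCs (H × ULift.{v} Bool)
  have := hη.isMarkovKernel
  let κ (z : 𝒳) : Kernel H (ULift.{v} Bool) := Kernel.const H (response x hr z)
  refine ⟨_, _, _, .cons C Cs H _ R κ η (fun _ => hC) hη, fun x' hx' h => ?_⟩
  rw [Kernel.compProd_apply_eq_compProd_sectR, Kernel.compProd_apply_eq_compProd_sectR,
    Kernel.const_apply, Kernel.const_apply, response_self, response_of_ne hx']
  exact ProfileAttains.answerLaw_compProd hr fun b => hval x' hx' (h, b)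

theorem RunProfileAttained.replicate_append (nbr : 𝒳 → 𝒳 → Prop) (hε : 0 < ε)
    (hCs : RunProfileAttained x Cs F) (n : ℕ) :
    RunProfileAttained x (List.replicate n (classDP nbr ε) ++ Cs)
      ((dpStep (Real.exp ε))^[n] F) := by
  induction n with
  | zero => exact hCs
  | succ n ih =>
    rw [Function.iterate_succ_apply']
    exact ih.cons (isRatioRange_inv (Real.one_lt_exp_iff.2 hε)) (isDP_response nbr x hε)

/-- The classes of `i` `ε`-DP mechanisms, one `ε`-BR mechanism and `m` further `ε`-DP mechanisms, in
this order. -/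
def dpWithBR (nbr : 𝒳 → 𝒳 → Prop) (ε : ℝ) (i m : ℕ) : List (MechClass.{u, v} 𝒳) :=
  List.replicate i (classDP nbr ε) ++ classBR nbr ε :: List.replicate m (classDP nbr ε)

theorem runProfileLE_dpWithBR (hε : 0 < ε) (hx : nbr x x') (hx' : nbr x' x) (i m : ℕ) :
    RunProfileLE.{u, v} x x' (dpWithBR nbr ε i m)
      ((dpStep (Real.exp ε))^[i + m] (brProfile (Real.exp ε))) := by
  have hc := Real.one_lt_exp_iff.2 hε
  rw [Function.iterate_add_apply]
  have htail := (runProfileLE_nil.{u, v} x x').replicate_append hε hx hx' m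
  rw [List.append_nil] at htail
  refine (htail.cons fun Y _ M hM => ?_).replicate_append hε hx hx' i
  obtain ⟨t, ht, hratio⟩ := IsBR.exists_hasRatioIn hM hx
  refine ⟨_, _, isRatioRange_div hc ht, hratio, ?_⟩
  rw [← ((chord_commute _ _ _ _).iterate_left m).eq]
  exact (isRatioRange_inv hc).chord_monotone.iterate m (chord_div_hockey_le_brProfile hc ht)

theorem runProfileAttained_dpWithBR (nbr : 𝒳 → 𝒳 → Prop) (x : 𝒳) (hε : 0 < ε) {t : ℝ}
    (ht : t ∈ Set.Icc 1 (Real.exp ε)) (i m : ℕ) :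
    RunProfileAttained.{u, v} x (dpWithBR nbr ε i m)
      ((dpStep (Real.exp ε))^[i + m] (chord (t / Real.exp ε) t hockey)) := by
  rw [Function.iterate_add_apply, ((chord_commute _ _ _ _).iterate_left m).eq]
  have htail := (runProfileAttained_nil.{u, v} x).replicate_append nbr hε m
  rw [List.append_nil] at htail
  exact (htail.cons (isRatioRange_div (Real.one_lt_exp_iff.2 hε) ht)
    (isBR_response nbr x hε ht)).replicate_append nbr hε i

end Run

/-! ### Comparison of adaptive classes -/

section Optimal

variable {𝒳 : Type u} {nbr : 𝒳 → 𝒳 → Prop} {x x' : 𝒳} {Cs : List (MechClass.{u, v} 𝒳)}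
  {F : ℝ → ℝ} {εg : ℝ}

theorem isDP_one {Y : Type v} [MeasurableSpace Y] (M : Mechanism 𝒳 Y) (εg : ℝ) :
    IsDP nbr M εg 1 := by
  intro x x' _ S _
  have hle : (M x S : ℝ) ≤ 1 := by exact_mod_cast (M x).apply_le_one S
  have hnonneg : 0 ≤ Real.exp εg * (M x' S : ℝ) := by positivity
  linarith

theorem deltaOptMech_nonneg {Y : Type v} [MeasurableSpace Y] (M : Mechanism 𝒳 Y) (εg : ℝ) :
    0 ≤ deltaOptMech nbr M εg :=
  Real.sInf_nonneg fun _ h => h.1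

theorem deltaOptMech_le {Y : Type v} [MeasurableSpace Y] {M : Mechanism 𝒳 Y} {δ : ℝ}
    (hδ : 0 ≤ δ) (h : IsDP nbr M εg δ) : deltaOptMech nbr M εg ≤ δ :=
  csInf_le ⟨0, fun _ h => h.1⟩ ⟨hδ, h⟩

theorem sub_le_deltaOptMech {Y : Type v} [MeasurableSpace Y] (M : Mechanism 𝒳 Y) (εg : ℝ)
    (hx : nbr x x') {S : Set Y} (hS : MeasurableSet S) :
    (M x S : ℝ) - Real.exp εg * (M x' S : ℝ) ≤ deltaOptMech nbr M εg :=
  le_csInf ⟨1, zero_le_one, isDP_one M εg⟩ fun _ hδ => sub_le_iff_le_add'.2 (hδ.2 x x' hx S hS)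

theorem deltaOptMech_le_deltaOpt {C : MechClass.{u, v} 𝒳} {Y : Type v} [MeasurableSpace Y]
    {M : Mechanism 𝒳 Y} (hM : M ∈ C Y) (εg : ℝ) :
    deltaOptMech nbr M εg ≤ deltaOpt nbr C εg := by
  refine le_csSup ⟨1, ?_⟩ ⟨Y, _, M, hM, rfl⟩
  rintro _ ⟨Y, _, M, _, rfl⟩
  exact deltaOptMech_le zero_le_one (isDP_one M εg)

theorem deltaOpt_nonneg (C : MechClass.{u, v} 𝒳) (εg : ℝ) : 0 ≤ deltaOpt nbr C εg := by
  refine Real.sSup_nonneg ?_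
  rintro _ ⟨Y, _, M, _, rfl⟩
  exact deltaOptMech_nonneg M εg

theorem IsAdaptiveRun.sub_le_deltaOpt {R : Type v} [MeasurableSpace R]
    {κ : 𝒳 → Kernel PUnit.{v + 1} R} (h : IsAdaptiveRun Cs PUnit.{v + 1} R κ) (εg : ℝ)
    (hx : nbr x x') {S : Set R} (hS : MeasurableSet S) :
    (κ x PUnit.unit).real S - Real.exp εg * (κ x' PUnit.unit).real S ≤
      deltaOpt nbr (adaptiveClass Cs) εg := by
  have := h.isMarkovKernel
  have hM : mechAt κ PUnit.unit ∈ adaptiveClass Cs R := ⟨κ, h, fun _ => rfl⟩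
  exact (sub_le_deltaOptMech _ εg hx hS).trans (deltaOptMech_le_deltaOpt hM εg)

theorem RunProfileAttained.le_deltaOpt (h : RunProfileAttained x Cs F) (hx : nbr x x')
    (hne : x' ≠ x) (εg : ℝ) : F (Real.exp εg) ≤ deltaOpt nbr (adaptiveClass Cs) εg := by
  obtain ⟨R, _, κ, hκ, hval⟩ := h PUnit
  obtain ⟨S, hS, hle⟩ := hval x' hne PUnit.unit (Real.exp εg)
  exact hle.trans (hκ.sub_le_deltaOpt εg hx hS)

theorem RunProfileAttained.hockey_le_deltaOpt (h : RunProfileAttained x Cs F) (hx : nbr x x)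
    (εg : ℝ) : hockey (Real.exp εg) ≤ deltaOpt nbr (adaptiveClass Cs) εg := by
  obtain ⟨R, _, κ, hκ, -⟩ := h PUnit
  have := hκ.isMarkovKernel x
  obtain ⟨S, hS, hle⟩ := profileAttains_hockey (P := κ x PUnit.unit) (Q := κ x PUnit.unit)
    (Real.exp εg)
  exact hle.trans (hκ.sub_le_deltaOpt εg hx hS)

theorem deltaOpt_adaptiveClass_le {δ : ℝ} (hδ : 0 ≤ δ)
    (h : ∀ x x', nbr x x' → ∃ F, RunProfileLE x x' Cs F ∧ F (Real.exp εg) ≤ δ) :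
    deltaOpt nbr (adaptiveClass Cs) εg ≤ δ := by
  refine Real.sSup_le ?_ hδ
  rintro _ ⟨R, _, M, ⟨κ, hκ, hM⟩, rfl⟩
  refine deltaOptMech_le hδ fun x x' hx S hS => ?_
  obtain ⟨F, hF, hle⟩ := h x x' hx
  rw [← ProbabilityMeasure.measureReal_eq_coe_coeFn, ← ProbabilityMeasure.measureReal_eq_coe_coeFn,
    hM, hM]
  exact sub_le_iff_le_add'.1 ((hF hκ PUnit.unit _ S hS).trans hle)

theorem deltaOpt_dpWithBR_le (hnbr : ∀ x x', nbr x x' → nbr x' x) {ε : ℝ} (hε : 0 < ε)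
    {i m i' m' : ℕ} (hlen : i + m = i' + m') (εg : ℝ) :
    deltaOpt nbr (adaptiveClass (dpWithBR.{u, v} nbr ε i m)) εg ≤
      deltaOpt nbr (adaptiveClass (dpWithBR.{u, v} nbr ε i' m')) εg := by
  refine deltaOpt_adaptiveClass_le (deltaOpt_nonneg _ εg) fun x x' hx => ?_
  obtain ⟨t, ht, heq⟩ := exists_dpStep_iterate_brProfile_eq (Real.one_lt_exp_iff.2 hε)
    (Real.exp_pos εg) (i + m)
  have hattained := runProfileAttained_dpWithBR.{u, v} nbr x hε ht i' m'
  rcases eq_or_ne x' x with rfl | hne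
  · exact ⟨hockey, runProfileLE_self _ _, hattained.hockey_le_deltaOpt hx εg⟩
  · refine ⟨_, runProfileLE_dpWithBR hε hx (hnbr x x' hx) i m, ?_⟩
    rw [heq, hlen]
    exact hattained.le_deltaOpt hx hne εg

end Optimal

theorem ofFn_eq_replicate_append_cons {α : Type*} {N : ℕ} {f : Fin N → α} {k : Fin N} {a d : α}
    (hk : f k = a) (h : ∀ i, i ≠ k → f i = d) :
    List.ofFn f = List.replicate k d ++ a :: List.replicate (N - 1 - k) d := by
  have hset : List.ofFn f = (List.replicate N d).set k a := by
    refine List.ext_getElem (by simp) fun n hn _ => ?_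
    rw [List.getElem_ofFn, List.getElem_set, List.getElem_replicate]
    split_ifs with hkn
    · simpa only [← hkn] using hk
    · exact h _ fun heq => hkn (congrArg Fin.val heq).symm
  rw [hset, List.set_eq_take_append_cons_drop, if_pos (by simp), List.take_replicate,
    List.drop_replicate, min_eq_left k.2.le, Nat.sub_sub, Nat.add_comm 1]

theorem mainTheorem5 {𝒳 : Type u} (nbr : 𝒳 → 𝒳 → Prop) (hnbr : ∀ x x', nbr x x' → nbr x' x)
    (ε : ℝ) (hε : 0 < ε) (N : ℕ) (A B : Fin N → MechClass.{u, v} 𝒳) (kA kB : Fin N)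
    (hA : A kA = classBR nbr ε) (hA' : ∀ i, i ≠ kA → A i = classDP nbr ε)
    (hB : B kB = classBR nbr ε) (hB' : ∀ j, j ≠ kB → B j = classDP nbr ε) (εg : ℝ) :
    deltaOpt nbr (adaptiveClass (List.ofFn A)) εg =
      deltaOpt nbr (adaptiveClass (List.ofFn B)) εg := by
  have hlen : (kA : ℕ) + (N - 1 - kA) = kB + (N - 1 - kB) := by omega
  rw [ofFn_eq_replicate_append_cons hA hA', ofFn_eq_replicate_append_cons hB hB']
  exact le_antisymm (deltaOpt_dpWithBR_le hnbr hε hlen εg)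
    (deltaOpt_dpWithBR_le hnbr hε hlen.symm εg)
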